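/- **Theorem 1.3.** Let a finite group $G$ act linearly on $\mathbb{C}^n$. For $r\in\mathbb{N}$ let $\mathcal{O}^r_G$ be the space of $r$-jets at $0$ of $G$-invariant holomorphic germs $(\mathbb{C}^n,0)\to(\mathbb{C},0)$ with a critical point at the origin; the $r$-jets of $G$-equivariant biholomorphic germs $(\mathbb{C}^n,0)\to(\mathbb{C}^n,0)$ form a group $D^r_G$ acting on $\mathcal{O}^r_G$ by composition. A $G$-invariant germ $f:(\mathbb{C}^n,0)\to(\mathbb{C},0)$ with a critical point at the origin is called *equivariantly simple* if there is $M\in\mathbb{N}$ such that, for all sufficiently large $r$, the $r$-jet of $f$ has a neighbourhood in $\mathcal{O}^r_G$ that meets at most $M$ orbits of $D^r_G$. The corank of a germ at a critical point is the dimension of the kernel of its Hessian form. For every $N\in\mathbb{N}$ there are a prime number $p$, an integer $n>N$, a nontrivial linear action of $\mathbb{Z}_p$ on $\mathbb{C}^n$ and a germ $f:(\mathbb{C}^n,0)\to(\mathbb{C},0)$ that is $\mathbb{Z}_p$-invariant and equivariantly simple for this action and has zero $2$-jet, $j^2(f)=0$, so that its corank is $n$. Moreover, $f$ can be taken to be a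 loop-type invertible polynomial $$f=x_1^{d_1}x_2+x_2^{d_2}x_3+\dots+x_{n-1}^{d_{n-1}}x_n+x_n^{d_n}x_1$$ with integers $d_1,\dots,d_n\ge 2$ such that $p-1=d_1d_2\cdots d_n$. (Thus $p>2^N$, and the corank of simple $\mathbb{Z}_p$-invariant germs is unbounded as $p$ grows.) -/

import Mathlib

open Filter Topology

/-- The space of `r`-jets at the origin of functions on `ℂⁿ`: families of `k`-linear forms, `k ≤ r`
(the derivatives of orders `0, …, r`), with its usual topology. -/
abbrev JetSpace (n r : ℕ) : Type :=
  (k : Fin (r + 1)) → ContinuousMultilinearMap ℂ (fun _ : Fin (k : ℕ) => (Fin n → ℂ)) ℂ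

/-- The `r`-jet of `f` at the origin. -/
noncomputable def jet {n : ℕ} (r : ℕ) (f : (Fin n → ℂ) → ℂ) : JetSpace n r :=
  fun k => iteratedFDeriv ℂ (k : ℕ) f 0

/-- `f` represents a holomorphic germ `(ℂⁿ, 0) → (ℂ, 0)` with a critical point at the origin which
is invariant under the linear action `ρ` of `G` on `ℂⁿ`. -/
structure IsInvariantCriticalGerm {G : Type} [Group G] {n : ℕ}
    (ρ : Representation ℂ G (Fin n → ℂ)) (f : (Fin n → ℂ) → ℂ) : Prop where
  analyticAt : AnalyticAt ℂ f 0
  map_zero : f 0 = 0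
  critical : fderiv ℂ f 0 = 0
  invariant : ∀ g : G, ∀ᶠ x in 𝓝 (0 : Fin n → ℂ), f (ρ g x) = f x

/-- `φ` represents the germ of a `G`-equivariant biholomorphism `(ℂⁿ, 0) → (ℂⁿ, 0)`. -/
structure IsEquivariantDiffeoGerm {G : Type} [Group G] {n : ℕ}
    (ρ : Representation ℂ G (Fin n → ℂ)) (φ : (Fin n → ℂ) → (Fin n → ℂ)) : Prop where
  analyticAt : AnalyticAt ℂ φ 0
  map_zero : φ 0 = 0
  exists_inverse : ∃ ψ : (Fin n → ℂ) → (Fin n → ℂ), AnalyticAt ℂ ψ 0 ∧ ψ 0 = 0 ∧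
    (∀ᶠ x in 𝓝 (0 : Fin n → ℂ), ψ (φ x) = x) ∧ (∀ᶠ x in 𝓝 (0 : Fin n → ℂ), φ (ψ x) = x)
  equivariant : ∀ g : G, ∀ᶠ x in 𝓝 (0 : Fin n → ℂ), φ (ρ g x) = ρ g (φ x)

/-- The space of `r`-jets of `G`-invariant germs `(ℂⁿ, 0) → (ℂ, 0)` with a critical point at the
origin. -/
def invariantJets {G : Type} [Group G] {n : ℕ}
    (ρ : Representation ℂ G (Fin n → ℂ)) (r : ℕ) : Set (JetSpace n r) :=
  {j | ∃ f, IsInvariantCriticalGerm ρ f ∧ jet r f = j}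

/-- The orbit of an invariant `r`-jet `j` under the group of `r`-jets of `G`-equivariant
diffeomorphism germs. That group acts by composition of representatives. -/
def jetOrbit {G : Type} [Group G] {n : ℕ}
    (ρ : Representation ℂ G (Fin n → ℂ)) (r : ℕ) (j : JetSpace n r) : Set (JetSpace n r) :=
  {j' | ∃ f φ, IsInvariantCriticalGerm ρ f ∧ jet r f = j ∧ IsEquivariantDiffeoGerm ρ φ ∧
    jet r (f ∘ φ) = j'}

/-- An invariant germ `f` with a critical point at the origin is equivariantly simple if there is
`N` such that for all sufficiently large `r` the `r`-jet of `f` has a neighbourhood in the space of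
invariant `r`-jets which meets at most `N` orbits. -/
def IsEquivariantlySimple {G : Type} [Group G] {n : ℕ}
    (ρ : Representation ℂ G (Fin n → ℂ)) (f : (Fin n → ℂ) → ℂ) : Prop :=
  IsInvariantCriticalGerm ρ f ∧
    ∃ N : ℕ, ∀ᶠ r : ℕ in atTop, ∃ U ∈ 𝓝 (jet r f),
      (jetOrbit ρ r '' (U ∩ invariantJets ρ r)).encard ≤ N

/-- The corank of a germ at the origin: the dimension of the kernel of its Hessian form. -/
noncomputable def corank {n : ℕ} (f : (Fin n → ℂ) → ℂ) : ℕ :=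
  Module.finrank ℂ (LinearMap.ker (fderiv ℂ (fderiv ℂ f) 0).toLinearMap)

/-- The loop-type invertible polynomial
`x₁ ^ d₁ * x₂ + x₂ ^ d₂ * x₃ + ⋯ + xₙ ^ dₙ * x₁`. -/
noncomputable def loopPolynomial {n : ℕ} (d : Fin n → ℕ) : MvPolynomial (Fin n) ℂ :=
  ∑ i, MvPolynomial.X i ^ d i * MvPolynomial.X (finRotate n i)

/-! The loop polynomial is chosen so that every nonconstant invariant monomial is an infinitesimal
equivariant coordinate change of it. At each jet level its orbit then fills a neighbourhood of its
jet among the invariant jets, so one orbit suffices and `M = 1` works.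

Take `k` even, a prime `p = 2 ^ k * m + 1`, exponents `2, …, 2, m` and weights `(-2) ^ i` modulo
`p`; the loop closes because `m * (-2) ^ k + 1 = p`. A monomial whose exponents all lie below `dᵢ`
has integer weight `∑ aᵢ (-2) ^ i` of absolute value less than `p`. If it is invariant, this integer
is zero, and uniqueness of base `-2` expansions makes the monomial constant
(`eq_zero_of_lt_loopExponents`).

Every other invariant monomial contains some `xᵢ ^ dᵢ`. Modulo the tangent space it equals `-dᵢ₊₁`
times another invariant monomial of the same quasi-degree (`monomial_add_mem_orbitTangent`). A
functional vanishing on the tangent space thus shrinks by a factor of at least 2 at each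
replacement, while only finitely many monomials have a given quasi-degree; so it vanishes on all of
them (`monomial_mem_orbitTangent`). The passage from the tangent space to orbits is the surjective
form of the inverse function theorem (`exists_nhds_polyPerturbation_eq`, `exists_nhds_jet_comp_eq`).
-/

/-! ### Taylor expansion of analytic germs -/

section IteratedFDeriv

variable {E F : Type*} [NormedAddCommGroup E] [NormedSpace ℂ E] [NormedAddCommGroup F]
  [NormedSpace ℂ F] [CompleteSpace F]

/-- The derivatives of order at most `r` of an analytic function that is `O(‖x‖ ^ (r + 1))`
vanish. -/
theorem iteratedFDeriv_eq_zero_of_isBigO {f : E → F} (hf : AnalyticAt ℂ f 0) {r : ℕ}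
    (h : f =O[𝓝 0] fun x => ‖x‖ ^ (r + 1)) {k : ℕ} (hk : k ≤ r) :
    iteratedFDeriv ℂ k f 0 = 0 := by
  obtain ⟨p, hp⟩ := hf
  have key : ∀ k ≤ r, ∀ y, (p k fun _ => y) = 0 := by
    intro k
    induction k using Nat.strong_induction_on with
    | _ k ih =>
      intro hk
      refine Asymptotics.IsBigO.continuousMultilinearMap_apply_eq_zero ?_
      have h1 := hp.isBigO_sub_partialSum_pow (k + 1)
      have h2 : f =O[𝓝 0] fun x => ‖x‖ ^ (k + 1) := by
        refine h.trans (Asymptotics.IsBigO.of_bound 1 ?_)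
        filter_upwards [Metric.ball_mem_nhds (0 : E) one_pos] with x hx
        have : ‖x‖ ≤ 1 := by simpa using (mem_ball_zero_iff.1 hx).le
        simpa using pow_le_pow_of_le_one (norm_nonneg x) this (by omega)
      refine (h2.sub h1).congr_left fun x => ?_
      have h3 : ∑ j ∈ Finset.range k, (p j fun _ => x) = 0 :=
        Finset.sum_eq_zero fun j hj =>
          ih j (Finset.mem_range.1 hj) ((Finset.mem_range.1 hj).le.trans hk) x
      simp [FormalMultilinearSeries.partialSum, Finset.sum_range_succ, h3]
  obtain ⟨ρ, hρ⟩ := hp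
  ext v
  -- Polarization: the derivative symmetrizes `p k`, hence depends only on the values of `p k` on
  -- the diagonal.
  rw [hρ.iteratedFDeriv_eq_sum_of_completeSpace, ← (p k).iteratedFDeriv_comp_diagonal 0 v]
  have : (fun x : E => p k fun _ => x) = fun _ => 0 := funext (key k hk)
  rw [this]
  simp

/-- Taylor's formula at an analytic point: the remainder is `O(‖x‖ ^ (r + 1))`. -/
theorem AnalyticAt.isBigO_sub_taylor {f : E → F} (hf : AnalyticAt ℂ f 0) (r : ℕ) :
    (fun x => f x - ∑ k ∈ Finset.range (r + 1),
      (k.factorial : ℂ)⁻¹ • iteratedFDeriv ℂ k f 0 fun _ => x) =O[𝓝 0] fun x => ‖x‖ ^ (r + 1) := by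
  obtain ⟨p, hp⟩ := hf
  refine (hp.isBigO_sub_partialSum_pow (r + 1)).congr_left fun x => ?_
  obtain ⟨ρ, hρ⟩ := hp
  rw [zero_add, FormalMultilinearSeries.partialSum]
  congr 1
  refine Finset.sum_congr rfl fun k _ => ?_
  have := hρ.factorial_smul x k
  rw [← this, ← Nat.cast_smul_eq_nsmul ℂ, smul_smul,
    inv_mul_cancel₀ (Nat.cast_ne_zero.2 k.factorial_ne_zero), one_smul]

end IteratedFDeriv

/-! ### Jets as germs modulo higher order terms -/

section Jet

variable {n : ℕ} {r : ℕ} {f g : (Fin n → ℂ) → ℂ}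

theorem jet_congr (h : f =ᶠ[𝓝 0] g) : jet r f = jet r g := by
  funext k
  exact (h.iteratedFDeriv ℂ k).eq_of_nhds

theorem jet_add (hf : AnalyticAt ℂ f 0) (hg : AnalyticAt ℂ g 0) :
    jet r (fun x => f x + g x) = jet r f + jet r g := by
  funext k
  exact iteratedFDeriv_add_apply hf.contDiffAt hg.contDiffAt

theorem jet_const_smul (c : ℂ) (hf : AnalyticAt ℂ f 0) :
    jet r (fun x => c * f x) = c • jet r f := by
  funext k
  exact iteratedFDeriv_const_smul_apply (a := c) (f := f) hf.contDiffAt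

theorem jet_sub (hf : AnalyticAt ℂ f 0) (hg : AnalyticAt ℂ g 0) :
    jet r (fun x => f x - g x) = jet r f - jet r g := by
  have h := jet_add (r := r) (hf.sub hg) hg
  simp only [Pi.sub_apply, sub_add_cancel] at h
  exact eq_sub_of_add_eq h.symm

/-- Analytic germs have the same `r`-jet if and only if they differ by `O(‖x‖ ^ (r + 1))`. -/
theorem jet_eq_iff (hf : AnalyticAt ℂ f 0) (hg : AnalyticAt ℂ g 0) :
    jet r f = jet r g ↔ (fun x => f x - g x) =O[𝓝 0] fun x => ‖x‖ ^ (r + 1) := by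
  rw [← sub_eq_zero, ← jet_sub hf hg]
  constructor
  · intro h
    refine ((hf.sub hg).isBigO_sub_taylor r).congr_left fun x => ?_
    have : ∑ k ∈ Finset.range (r + 1), (k.factorial : ℂ)⁻¹ •
        iteratedFDeriv ℂ k (fun x => f x - g x) 0 (fun _ => x) = 0 := by
      refine Finset.sum_eq_zero fun k hk => ?_
      have : iteratedFDeriv ℂ k (fun x => f x - g x) 0 = 0 :=
        congrFun h (⟨k, Finset.mem_range.1 hk⟩ : Fin (r + 1))
      simp [this]
    exact (congrArg (fun t => f x - g x - t) this).trans (sub_zero _)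
  · intro h
    funext k
    exact iteratedFDeriv_eq_zero_of_isBigO (hf.sub hg) h (Nat.le_of_lt_succ k.2)

/-- Since `φ x = O(x)`, composition preserves the order of vanishing of `f - g`. This allows
representatives to be exchanged freely inside `jetOrbit`. -/
theorem jet_comp_congr (hf : AnalyticAt ℂ f 0) (hg : AnalyticAt ℂ g 0) (h : jet r f = jet r g)
    {φ : (Fin n → ℂ) → (Fin n → ℂ)} (hφ : AnalyticAt ℂ φ 0) (hφ0 : φ 0 = 0) :
    jet r (f ∘ φ) = jet r (g ∘ φ) := by
  rw [← hφ0] at hf hg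
  rw [jet_eq_iff (hf.comp hφ) (hg.comp hφ)]
  rw [hφ0] at hf hg
  rw [jet_eq_iff hf hg] at h
  have ht : Tendsto φ (𝓝 0) (𝓝 0) := by simpa [hφ0] using hφ.continuousAt.tendsto
  have h1 := h.comp_tendsto ht
  have h2 : φ =O[𝓝 0] fun x => x := by
    simpa [hφ0] using hφ.differentiableAt.isBigO_sub
  exact h1.trans (h2.norm_norm.pow (r + 1))

end Jet

/-! ### Equivariant coordinate changes and orbits of jets -/

section Orbit

variable {G : Type} [Group G] {n : ℕ} {ρ : Representation ℂ G (Fin n → ℂ)}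

theorem Representation.tendsto_apply_zero (ρ : Representation ℂ G (Fin n → ℂ)) (g : G) :
    Tendsto (ρ g) (𝓝 0) (𝓝 0) := by
  have h : Continuous (ρ g) := LinearMap.continuous_of_finiteDimensional _
  simpa using h.tendsto 0

namespace IsEquivariantDiffeoGerm

variable {φ ψ : (Fin n → ℂ) → (Fin n → ℂ)}

theorem tendsto (hφ : IsEquivariantDiffeoGerm ρ φ) : Tendsto φ (𝓝 0) (𝓝 0) := by
  simpa [hφ.map_zero] using hφ.analyticAt.continuousAt.tendsto

theorem comp (hφ : IsEquivariantDiffeoGerm ρ φ) (hψ : IsEquivariantDiffeoGerm ρ ψ) :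
    IsEquivariantDiffeoGerm ρ (φ ∘ ψ) where
  analyticAt := AnalyticAt.comp (by rw [hψ.map_zero]; exact hφ.analyticAt) hψ.analyticAt
  map_zero := by simp [hφ.map_zero, hψ.map_zero]
  exists_inverse := by
    obtain ⟨φ', a1, z1, l1, r1⟩ := hφ.exists_inverse
    obtain ⟨ψ', a2, z2, l2, r2⟩ := hψ.exists_inverse
    have t1 : Tendsto φ' (𝓝 0) (𝓝 0) := by simpa [z1] using a1.continuousAt.tendsto
    refine ⟨ψ' ∘ φ', AnalyticAt.comp (by rwa [z1]) a1, by simp [z1, z2], ?_, ?_⟩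
    · filter_upwards [l2, hψ.tendsto.eventually l1] with x h1 h2
      simp [h1, h2]
    · filter_upwards [r1, t1.eventually r2] with x h1 h2
      simp [h1, h2]
  equivariant g := by
    filter_upwards [hψ.equivariant g, hψ.tendsto.eventually (hφ.equivariant g)] with x h1 h2
    simp [h1, h2]

theorem exists_symm (hφ : IsEquivariantDiffeoGerm ρ φ) : ∃ ψ, IsEquivariantDiffeoGerm ρ ψ ∧
    ∀ᶠ x in 𝓝 (0 : Fin n → ℂ), φ (ψ x) = x := by
  obtain ⟨ψ, ha, h0, hl, hr⟩ := hφ.exists_inverse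
  have ht : Tendsto ψ (𝓝 0) (𝓝 0) := by simpa [h0] using ha.continuousAt.tendsto
  refine ⟨ψ, ⟨ha, h0, ⟨φ, hφ.analyticAt, hφ.map_zero, hr, hl⟩, fun g => ?_⟩, hr⟩
  have ht' := (ρ.tendsto_apply_zero g).comp ht
  filter_upwards [hr, ht.eventually (hφ.equivariant g), ht'.eventually hl] with x h1 h2 h3
  rw [Function.comp_apply, h2, h1] at h3
  exact h3

end IsEquivariantDiffeoGerm

theorem IsInvariantCriticalGerm.comp {f : (Fin n → ℂ) → ℂ} {φ : (Fin n → ℂ) → (Fin n → ℂ)}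
    (hf : IsInvariantCriticalGerm ρ f) (hφ : IsEquivariantDiffeoGerm ρ φ) :
    IsInvariantCriticalGerm ρ (f ∘ φ) := by
  have hfa : AnalyticAt ℂ f (φ 0) := by rw [hφ.map_zero]; exact hf.analyticAt
  refine ⟨hfa.comp hφ.analyticAt, by simp [hφ.map_zero, hf.map_zero], ?_, fun g => ?_⟩
  · rw [fderiv_comp _ hfa.differentiableAt hφ.analyticAt.differentiableAt, hφ.map_zero,
      hf.critical, ContinuousLinearMap.zero_comp]
  · filter_upwards [hφ.equivariant g, hφ.tendsto.eventually (hf.invariant g)] with x h1 h2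
    simp [h1, h2]

/-- Jets of invariant germs which differ by a coordinate change have the same orbit. -/
theorem jetOrbit_jet_comp {f : (Fin n → ℂ) → ℂ} {φ : (Fin n → ℂ) → (Fin n → ℂ)} {r : ℕ}
    (hf : IsInvariantCriticalGerm ρ f) (hφ : IsEquivariantDiffeoGerm ρ φ) :
    jetOrbit ρ r (jet r (f ∘ φ)) = jetOrbit ρ r (jet r f) := by
  ext j
  constructor
  · rintro ⟨h, ψ, hh, hj, hψ, rfl⟩
    refine ⟨f, φ ∘ ψ, hf, rfl, hφ.comp hψ, ?_⟩
    exact jet_comp_congr (hf.comp hφ).analyticAt hh.analyticAt hj.symm hψ.analyticAt hψ.map_zero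
  · rintro ⟨h, ψ, hh, hj, hψ, rfl⟩
    obtain ⟨φ', hφ', hr⟩ := hφ.exists_symm
    refine ⟨f ∘ φ, φ' ∘ ψ, hf.comp hφ, rfl, hφ'.comp hψ, ?_⟩
    rw [jet_comp_congr hh.analyticAt hf.analyticAt hj hψ.analyticAt hψ.map_zero]
    refine jet_congr ?_
    filter_upwards [hψ.tendsto.eventually hr] with x h1
    simp [h1]

end Orbit

/-! ### Reduction of jets to polynomials -/

section PolyJet

variable {n : ℕ}

theorem MvPolynomial.analyticAt_eval (h : MvPolynomial (Fin n) ℂ) (x : Fin n → ℂ) :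
    AnalyticAt ℂ (fun x => MvPolynomial.eval x h) x :=
  AnalyticOnNhd.eval_mvPolynomial h x (Set.mem_univ x)

/-- The `r`-jet of a polynomial function, as a linear map. -/
noncomputable def polyJet (n r : ℕ) : MvPolynomial (Fin n) ℂ →ₗ[ℂ] JetSpace n r where
  toFun h := jet r fun x => MvPolynomial.eval x h
  map_add' g h := by
    simpa using jet_add (g.analyticAt_eval 0) (h.analyticAt_eval 0)
  map_smul' c h := by
    simpa using jet_const_smul c (h.analyticAt_eval 0)

theorem polyJet_apply (r : ℕ) (h : MvPolynomial (Fin n) ℂ) :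
    polyJet n r h = jet r fun x => MvPolynomial.eval x h := rfl

theorem MvPolynomial.isBigO_eval_monomial (a : Fin n →₀ ℕ) (c : ℂ) :
    (fun x : Fin n → ℂ => MvPolynomial.eval x (MvPolynomial.monomial a c)) =O[𝓝 0]
      fun x => ‖x‖ ^ a.degree := by
  refine Asymptotics.IsBigO.of_bound ‖c‖ (Eventually.of_forall fun x => ?_)
  rw [MvPolynomial.eval_monomial, norm_mul, Finsupp.degree_eq_sum, ← Finset.prod_pow_eq_pow_sum,
    Finsupp.prod_fintype _ _ (fun i => pow_zero _), norm_prod,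
    Real.norm_of_nonneg (Finset.prod_nonneg fun i _ => by positivity)]
  gcongr with i
  rw [norm_pow]
  gcongr
  exact norm_le_pi_norm x i

theorem isBigO_norm_pow_of_le {k l : ℕ} (h : k ≤ l) :
    (fun x : Fin n → ℂ => ‖x‖ ^ l) =O[𝓝 0] fun x => ‖x‖ ^ k := by
  refine Asymptotics.IsBigO.of_bound 1 ?_
  filter_upwards [Metric.ball_mem_nhds (0 : Fin n → ℂ) one_pos] with x hx
  have : ‖x‖ ≤ 1 := by simpa using (mem_ball_zero_iff.1 hx).le
  simpa using pow_le_pow_of_le_one (norm_nonneg x) this h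

theorem polyJet_monomial_eq_zero {r : ℕ} {a : Fin n →₀ ℕ} (h : r < a.degree) (c : ℂ) :
    polyJet n r (MvPolynomial.monomial a c) = 0 := by
  have h0 : polyJet n r 0 = 0 := map_zero _
  rw [← h0, polyJet_apply, polyJet_apply,
    jet_eq_iff (MvPolynomial.analyticAt_eval _ 0) (MvPolynomial.analyticAt_eval _ 0)]
  simpa using (MvPolynomial.isBigO_eval_monomial a c).trans (isBigO_norm_pow_of_le h)

/-- A multilinear form evaluated on the diagonal is a polynomial function. -/
theorem MultilinearMap.exists_mvPolynomial_eval_eq {k : ℕ}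
    (m : MultilinearMap ℂ (fun _ : Fin k => (Fin n → ℂ)) ℂ) :
    ∃ P : MvPolynomial (Fin n) ℂ, ∀ x, MvPolynomial.eval x P = m fun _ => x := by
  refine ⟨∑ s : Fin k → Fin n, MvPolynomial.C (m fun i => Pi.single (s i) 1) *
    ∏ i, MvPolynomial.X (s i), fun x => ?_⟩
  have hx : (fun _ : Fin k => x) = fun _ => ∑ j, x j • (Pi.single j 1 : Fin n → ℂ) := by
    funext _
    exact pi_eq_sum_univ' x
  rw [hx, m.map_sum]
  simp [m.map_smul_univ, mul_comm]

theorem exists_polyJet_eq_jet {f : (Fin n → ℂ) → ℂ} (hf : AnalyticAt ℂ f 0) (r : ℕ) :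
    ∃ P, polyJet n r P = jet r f := by
  choose P hP using fun k : ℕ =>
    (iteratedFDeriv ℂ k f 0).toMultilinearMap.exists_mvPolynomial_eval_eq
  refine ⟨∑ k ∈ Finset.range (r + 1), (k.factorial : ℂ)⁻¹ • P k, Eq.symm ?_⟩
  rw [polyJet_apply, jet_eq_iff hf (MvPolynomial.analyticAt_eval _ 0)]
  refine (hf.isBigO_sub_taylor r).congr_left fun x => ?_
  simp [hP]

end PolyJet

/-! ### Diagonal cyclic actions and their invariant jets -/

section DiagRep

variable {n p : ℕ}

/-- The diagonal action of `ℤ/p` on `ℂⁿ` with weights `w`. -/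
noncomputable def diagRep (p : ℕ) [NeZero p] (w : Fin n → ZMod p) :
    Representation ℂ (Multiplicative (ZMod p)) (Fin n → ℂ) where
  toFun g := LinearMap.pi fun i => ZMod.stdAddChar (g.toAdd * w i) • LinearMap.proj i
  map_one' := by ext; simp
  map_mul' g h := by
    ext
    simp [add_mul, AddChar.map_add_eq_mul, mul_assoc]

theorem diagRep_apply [NeZero p] (w : Fin n → ZMod p) (g : Multiplicative (ZMod p)) (x : Fin n → ℂ)
    (i : Fin n) : diagRep p w g x i = ZMod.stdAddChar (g.toAdd * w i) * x i := rfl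

theorem AddChar.map_finset_sum {A M ι : Type*} [AddCommMonoid A] [CommMonoid M] (ψ : AddChar A M)
    (s : Finset ι) (f : ι → A) : ψ (∑ i ∈ s, f i) = ∏ i ∈ s, ψ (f i) :=
  map_prod ψ.toMonoidHom (fun i => Multiplicative.ofAdd (f i)) s

theorem MvPolynomial.eval_diagRep_monomial [NeZero p] (w : Fin n → ZMod p) (g : Multiplicative (ZMod p))
    (x : Fin n → ℂ) (a : Fin n →₀ ℕ) (c : ℂ) :
    eval (diagRep p w g x) (monomial a c) =
      ZMod.stdAddChar (g.toAdd * Finsupp.weight w a) * eval x (monomial a c) := by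
  rw [eval_monomial, eval_monomial, Finsupp.weight_apply, Finsupp.sum_fintype _ _ (by simp),
    Finsupp.prod_fintype _ _ (by simp), Finsupp.prod_fintype _ _ (by simp), Finset.mul_sum,
    AddChar.map_finset_sum]
  simp only [diagRep_apply, mul_pow, Finset.prod_mul_distrib, mul_smul_comm,
    AddChar.map_nsmul_eq_pow]
  ring

theorem MvPolynomial.IsWeightedHomogeneous.eval_diagRep [NeZero p] {w : Fin n → ZMod p} {m : ZMod p}
    {h : MvPolynomial (Fin n) ℂ} (hh : IsWeightedHomogeneous w h m) (g : Multiplicative (ZMod p))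
    (x : Fin n → ℂ) :
    eval (diagRep p w g x) h = ZMod.stdAddChar (g.toAdd * m) * eval x h := by
  rw [h.as_sum, map_sum, map_sum, Finset.mul_sum]
  refine Finset.sum_congr rfl fun a ha => ?_
  rw [eval_diagRep_monomial, hh (mem_support_iff.1 ha)]

theorem MvPolynomial.IsWeightedHomogeneous.eval_zero {w : Fin n → ZMod p} {m : ZMod p}
    {h : MvPolynomial (Fin n) ℂ} (hh : IsWeightedHomogeneous w h m) (hm : m ≠ 0) :
    eval 0 h = 0 := by
  have : coeff 0 h = 0 := hh.coeff_eq_zero 0 (by simpa using hm.symm)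
  rwa [← constantCoeff_eq, ← eval_zero'] at this

/-- The nonconstant exponents of degree at most `r` and weight zero. -/
def invariantExponents (w : Fin n → ZMod p) (r : ℕ) : Set (Fin n →₀ ℕ) :=
  {a | Finsupp.weight w a = 0 ∧ a ≠ 0 ∧ a.degree ≤ r}

theorem finite_invariantExponents (w : Fin n → ZMod p) (r : ℕ) :
    (invariantExponents w r).Finite :=
  (Finsupp.finite_of_degree_le r).subset fun _ ha => ha.2.2

/-- The span of the `r`-jets of the nonconstant invariant monomials. -/
noncomputable def invariantJetSpan (w : Fin n → ZMod p) (r : ℕ) : Submodule ℂ (JetSpace n r) :=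
  Submodule.span ℂ ((fun a => polyJet n r (MvPolynomial.monomial a 1)) '' invariantExponents w r)

instance (w : Fin n → ZMod p) (r : ℕ) : FiniteDimensional ℂ (invariantJetSpan w r) :=
  FiniteDimensional.span_of_finite ℂ ((finite_invariantExponents w r).image _)

theorem polyJet_monomial_mem {w : Fin n → ZMod p} (r : ℕ) {a : Fin n →₀ ℕ}
    (ha : Finsupp.weight w a = 0) (h0 : a ≠ 0) :
    polyJet n r (MvPolynomial.monomial a 1) ∈ invariantJetSpan w r := by
  by_cases h : a.degree ≤ r
  · exact Submodule.subset_span ⟨a, ⟨ha, h0, h⟩, rfl⟩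
  · rw [polyJet_monomial_eq_zero (by omega)]
    exact Submodule.zero_mem _

theorem polyJet_eq_sum (r : ℕ) (h : MvPolynomial (Fin n) ℂ) :
    polyJet n r h = ∑ a ∈ h.support, h.coeff a • polyJet n r (MvPolynomial.monomial a 1) := by
  conv_lhs => rw [h.as_sum, map_sum]
  refine Finset.sum_congr rfl fun a _ => ?_
  rw [← map_smul, MvPolynomial.smul_monomial, smul_eq_mul, mul_one]

theorem polyJet_mem {w : Fin n → ZMod p} (r : ℕ) {h : MvPolynomial (Fin n) ℂ}
    (hh : MvPolynomial.IsWeightedHomogeneous w h 0) (h0 : h.coeff 0 = 0) :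
    polyJet n r h ∈ invariantJetSpan w r := by
  rw [polyJet_eq_sum]
  refine Submodule.sum_mem _ fun a ha => Submodule.smul_mem _ _ ?_
  rw [MvPolynomial.mem_support_iff] at ha
  exact polyJet_monomial_mem r (hh ha) (by rintro rfl; exact ha h0)

/-- Jets of invariant germs are combinations of jets of invariant monomials. -/
theorem invariantJets_subset [NeZero p] (w : Fin n → ZMod p) (r : ℕ) :
    invariantJets (diagRep p w) r ⊆ invariantJetSpan w r := by
  classical
  rintro _ ⟨f, hf, rfl⟩
  obtain ⟨P, hP⟩ := exists_polyJet_eq_jet hf.analyticAt r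
  have hP0 : P.coeff 0 = 0 := by
    have h1 := congrFun hP 0
    have h2 : iteratedFDeriv ℂ 0 (fun x => MvPolynomial.eval x P) 0 = iteratedFDeriv ℂ 0 f 0 := h1
    have h3 := congrArg (fun m => m 0) h2
    simp only [iteratedFDeriv_zero_apply, hf.map_zero] at h3
    rwa [← MvPolynomial.constantCoeff_eq, ← MvPolynomial.eval_zero']
  have key : ∀ g : ZMod p, jet r f = ∑ a ∈ P.support,
      (ZMod.stdAddChar (g * Finsupp.weight w a) * P.coeff a) •
        polyJet n r (MvPolynomial.monomial a 1) := by
    intro g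
    have hρ : AnalyticAt ℂ (diagRep p w (Multiplicative.ofAdd g)) 0 :=
      (LinearMap.toContinuousLinearMap (diagRep p w (Multiplicative.ofAdd g))).analyticAt 0
    have h1 : jet r f = jet r (f ∘ diagRep p w (Multiplicative.ofAdd g)) :=
      (jet_congr (hf.invariant _)).symm
    rw [h1, ← jet_comp_congr (P.analyticAt_eval 0) hf.analyticAt hP hρ (map_zero _)]
    have h2 : ((fun x => MvPolynomial.eval x P) ∘ diagRep p w (Multiplicative.ofAdd g)) =
        fun x => MvPolynomial.eval x (∑ a ∈ P.support, (ZMod.stdAddChar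
          (g * Finsupp.weight w a) * P.coeff a) • MvPolynomial.monomial a (1 : ℂ)) := by
      funext x
      conv_lhs => rw [P.as_sum]
      simp only [Function.comp_apply, map_sum, MvPolynomial.eval_diagRep_monomial]
      refine Finset.sum_congr rfl fun a _ => ?_
      rw [MvPolynomial.smul_monomial, MvPolynomial.eval_monomial, MvPolynomial.eval_monomial]
      simp [mul_assoc]
    rw [h2, ← polyJet_apply, map_sum]
    simp only [map_smul]
  -- Averaging over the group: orthogonality of characters kills the monomials of nonzero weight.
  have hsum : p • jet r f = ∑ a ∈ P.support,
      ((∑ g : ZMod p, ZMod.stdAddChar (g * Finsupp.weight w a)) * P.coeff a) •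
        polyJet n r (MvPolynomial.monomial a 1) := by
    have h1 : ∑ _g : ZMod p, jet r f = p • jet r f := by
      rw [Finset.sum_const, Finset.card_univ, ZMod.card]
    rw [← h1, Finset.sum_congr rfl fun g _ => key g, Finset.sum_comm]
    refine Finset.sum_congr rfl fun a _ => ?_
    rw [Finset.sum_mul]
    exact Finset.sum_smul.symm
  have hp : (p : ℂ) ≠ 0 := Nat.cast_ne_zero.2 (NeZero.ne p)
  rw [SetLike.mem_coe, ← Submodule.smul_mem_iff _ hp, Nat.cast_smul_eq_nsmul, hsum]
  refine Submodule.sum_mem _ fun a ha => ?_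
  rw [AddChar.sum_mulShift _ (ZMod.isPrimitive_stdAddChar p)]
  split_ifs with h
  · refine Submodule.smul_mem _ _ (polyJet_monomial_mem r h ?_)
    rintro rfl
    exact MvPolynomial.mem_support_iff.1 ha hP0
  · rw [Nat.cast_zero, zero_mul]
    exact (zero_smul ℂ (polyJet n r (MvPolynomial.monomial a 1))).symm ▸ Submodule.zero_mem _

end DiagRep

/-! ### From the tangent space to an open orbit -/

section OpenOrbit

variable {n p : ℕ}

/-- A family of polynomials homogeneous of the degrees of the variables, added to the identity. -/
noncomputable def polyPerturbation {κ : Type*} [Fintype κ] (ξ : κ → Fin n → MvPolynomial (Fin n) ℂ)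
    (c : κ → ℂ) (i : Fin n) : MvPolynomial (Fin n) ℂ :=
  MvPolynomial.X i + ∑ k, c k • ξ k i

/-- The elements `∑ ξᵢ ∂f/∂xᵢ` for weighted homogeneous polynomial vector fields `ξ` of degree
zero. -/
noncomputable def orbitTangent (w : Fin n → ZMod p) (f : MvPolynomial (Fin n) ℂ) :
    Submodule ℂ (MvPolynomial (Fin n) ℂ) where
  carrier := {h | ∃ ξ : Fin n → MvPolynomial (Fin n) ℂ,
    (∀ i, (ξ i).IsWeightedHomogeneous w (w i)) ∧ h = ∑ i, ξ i * MvPolynomial.pderiv i f}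
  add_mem' := by
    rintro _ _ ⟨ξ, hξ, rfl⟩ ⟨η, hη, rfl⟩
    exact ⟨ξ + η, fun i => (hξ i).add (hη i), by simp [add_mul, Finset.sum_add_distrib]⟩
  zero_mem' := ⟨0, fun i => MvPolynomial.isWeightedHomogeneous_zero _ _ _, by simp⟩
  smul_mem' := by
    rintro c _ ⟨ξ, hξ, rfl⟩
    exact ⟨c • ξ, fun i => Submodule.smul_mem (MvPolynomial.weightedHomogeneousSubmodule ℂ w (w i)) c
      (hξ i), by simp [Finset.smul_sum]⟩

theorem exists_local_inverse {φ : (Fin n → ℂ) → (Fin n → ℂ)} (hφ : AnalyticAt ℂ φ 0)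
    (h0 : φ 0 = 0) (hu : IsUnit (fderiv ℂ φ 0)) :
    ∃ ψ : (Fin n → ℂ) → (Fin n → ℂ), AnalyticAt ℂ ψ 0 ∧ ψ 0 = 0 ∧
      (∀ᶠ x in 𝓝 (0 : Fin n → ℂ), ψ (φ x) = x) ∧ (∀ᶠ x in 𝓝 (0 : Fin n → ℂ), φ (ψ x) = x) := by
  obtain ⟨u, hu⟩ := hu
  set e := ContinuousLinearEquiv.ofUnit u with he
  have hd : HasStrictFDerivAt φ (e : (Fin n → ℂ) →L[ℂ] (Fin n → ℂ)) 0 := by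
    have := hφ.hasStrictFDerivAt
    rw [← hu] at this
    exact this
  have ha : AnalyticAt ℂ ((hd.toOpenPartialHomeomorph φ).symm) (φ 0) :=
    (hd.toOpenPartialHomeomorph φ).analyticAt_symm' (i := e)
      hd.mem_toOpenPartialHomeomorph_source hφ hd.hasFDerivAt.fderiv
  have hr := hd.eventually_right_inverse
  rw [h0] at ha hr
  refine ⟨hd.localInverse φ e 0, ha, ?_, hd.eventually_left_inverse, hr⟩
  have := hd.localInverse_apply_image
  rwa [h0] at this

/-- First-order Taylor expansion of `f(x + tη)`, with `t` the variable of the outer polynomial ring;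
the linear coefficient obeys the Leibniz rule. -/
theorem coeff_aeval_add_X_mul (η : Fin n → MvPolynomial (Fin n) ℂ) (f : MvPolynomial (Fin n) ℂ) :
    (MvPolynomial.aeval (fun i => Polynomial.C (MvPolynomial.X i) +
        Polynomial.X * Polynomial.C (η i)) f : Polynomial (MvPolynomial (Fin n) ℂ)).coeff 0 = f ∧
    (MvPolynomial.aeval (fun i => Polynomial.C (MvPolynomial.X i) +
        Polynomial.X * Polynomial.C (η i)) f : Polynomial (MvPolynomial (Fin n) ℂ)).coeff 1 =
      ∑ i, η i * MvPolynomial.pderiv i f := by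
  induction f using MvPolynomial.induction_on with
  | C a =>
    rw [MvPolynomial.aeval_C, Polynomial.algebraMap_apply]
    simp [Polynomial.coeff_C, MvPolynomial.algebraMap_eq]
  | add f g hf hg =>
    rw [map_add, Polynomial.coeff_add, Polynomial.coeff_add, hf.1, hf.2, hg.1, hg.2]
    simp [mul_add, Finset.sum_add_distrib]
  | mul_X f i hf =>
    rw [map_mul, Polynomial.mul_coeff_zero, Polynomial.mul_coeff_one, hf.1, hf.2,
      MvPolynomial.aeval_X]
    refine ⟨by simp, ?_⟩
    simp [Polynomial.coeff_C, Derivation.leibniz, MvPolynomial.pderiv_X, Pi.single_apply, mul_add,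
      Finset.sum_add_distrib, Finset.sum_mul]
    rw [mul_comm f, add_right_inj]
    exact Finset.sum_congr rfl fun j _ => by ring

variable {κ : Type*} [Fintype κ]

/-- Polynomial dependence on the parameters `c`, from which the smoothness of the orbit map follows.
-/
theorem aeval_polyPerturbation_eq_sum (ξ : κ → Fin n → MvPolynomial (Fin n) ℂ)
    (f : MvPolynomial (Fin n) ℂ) : ∃ (s : Finset (κ →₀ ℕ)) (h : (κ →₀ ℕ) → MvPolynomial (Fin n) ℂ),
    ∀ c, MvPolynomial.aeval (polyPerturbation ξ c) f = ∑ d ∈ s, (∏ k, c k ^ d k) • h d := by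
  set P : MvPolynomial κ (MvPolynomial (Fin n) ℂ) := MvPolynomial.aeval (fun i =>
    MvPolynomial.C (MvPolynomial.X i) + ∑ k, MvPolynomial.X k * MvPolynomial.C (ξ k i)) f with hP
  refine ⟨P.support, fun d => P.coeff d, fun c => ?_⟩
  have h1 : MvPolynomial.aeval (polyPerturbation ξ c) f =
      MvPolynomial.eval (fun k => MvPolynomial.C (c k)) P := by
    have h2 := MvPolynomial.comp_aeval_apply (φ := ((MvPolynomial.aeval (R := MvPolynomial (Fin n) ℂ)
      (fun k => MvPolynomial.C (c k) : κ → MvPolynomial (Fin n) ℂ)).restrictScalars ℂ)) (fun i =>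
      MvPolynomial.C (MvPolynomial.X i) + ∑ k, MvPolynomial.X k * MvPolynomial.C (ξ k i)) f
    rw [← hP] at h2
    refine Eq.trans ?_ h2.symm
    congr 2
    funext i
    simp [polyPerturbation, MvPolynomial.smul_eq_C_mul]
  rw [h1, MvPolynomial.eval_eq']
  refine Finset.sum_congr rfl fun d _ => ?_
  simp only [MvPolynomial.smul_eq_C_mul, map_prod, map_pow, mul_comm]

/-- Restriction to the line through `c`, which identifies the directional derivative of the orbit
map at the origin. -/
theorem aeval_polyPerturbation_smul (ξ : κ → Fin n → MvPolynomial (Fin n) ℂ)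
    (f : MvPolynomial (Fin n) ℂ) (c : κ → ℂ) :
    ∃ q : Polynomial (MvPolynomial (Fin n) ℂ),
      q.coeff 1 = ∑ i, (∑ k, c k • ξ k i) * MvPolynomial.pderiv i f ∧
      ∀ t : ℂ, MvPolynomial.aeval (polyPerturbation ξ (t • c)) f =
        ∑ j ∈ q.support, t ^ j • q.coeff j := by
  refine ⟨_, (coeff_aeval_add_X_mul (fun i => ∑ k, c k • ξ k i) f).2, fun t => ?_⟩
  set q : Polynomial (MvPolynomial (Fin n) ℂ) := MvPolynomial.aeval (fun i =>
    Polynomial.C (MvPolynomial.X i) + Polynomial.X * Polynomial.C (∑ k, c k • ξ k i)) f with hq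
  have h1 : MvPolynomial.aeval (polyPerturbation ξ (t • c)) f =
      Polynomial.eval (MvPolynomial.C t) q := by
    have h2 := MvPolynomial.comp_aeval_apply (φ := ((Polynomial.aeval (R := MvPolynomial (Fin n) ℂ)
      (MvPolynomial.C t : MvPolynomial (Fin n) ℂ)).restrictScalars ℂ)) (fun i =>
      Polynomial.C (MvPolynomial.X i) + Polynomial.X * Polynomial.C (∑ k, c k • ξ k i)) f
    rw [← hq] at h2
    refine Eq.trans ?_ h2.symm
    congr 2
    funext i
    simp [polyPerturbation, MvPolynomial.smul_eq_C_mul, Finset.mul_sum, mul_assoc,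
      Polynomial.eval_finsetSum]
  rw [h1, Polynomial.eval_eq_sum, Polynomial.sum]
  refine Finset.sum_congr rfl fun j _ => ?_
  rw [MvPolynomial.smul_eq_C_mul, map_pow, mul_comm]

variable {V : Type*} [NormedAddCommGroup V] [NormedSpace ℂ V]

/-- A linear image of `f ∘ (id + ∑ c k • ξ k)` is strictly differentiable in `c` at the origin, with
derivative the infinitesimal action of the vector fields `ξ k` on `f`. -/
theorem hasStrictFDerivAt_polyPerturbation (J : MvPolynomial (Fin n) ℂ →ₗ[ℂ] V)
    (ξ : κ → Fin n → MvPolynomial (Fin n) ℂ) (f : MvPolynomial (Fin n) ℂ) :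
    ∃ L : (κ → ℂ) →L[ℂ] V,
      HasStrictFDerivAt (fun c => J (MvPolynomial.aeval (polyPerturbation ξ c) f)) L 0 ∧
      ∀ c, L c = J (∑ i, (∑ k, c k • ξ k i) * MvPolynomial.pderiv i f) := by
  obtain ⟨s, h, hs⟩ := aeval_polyPerturbation_eq_sum ξ f
  have hQ : ContDiff ℂ 1 (fun c => J (MvPolynomial.aeval (polyPerturbation ξ c) f)) := by
    simp only [hs, map_sum, map_smul]
    exact ContDiff.sum fun d _ =>
      (contDiff_prod fun k _ => (contDiff_apply ℂ ℂ k).pow (d k)).smul contDiff_const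
  have hst := hQ.contDiffAt.hasStrictFDerivAt (x := 0) one_ne_zero
  refine ⟨_, hst, fun c => ?_⟩
  obtain ⟨q, hq1, hq⟩ := aeval_polyPerturbation_smul ξ f c
  have hline : HasDerivAt (fun t : ℂ => t • c) c 0 := by
    simpa using (hasDerivAt_id (0 : ℂ)).smul_const c
  have hfd := hst.hasFDerivAt
  rw [show (0 : κ → ℂ) = (0 : ℂ) • c by simp] at hfd
  have h1 := hfd.comp_hasDerivAt (0 : ℂ) hline
  have h2 : HasDerivAt (fun t : ℂ => ∑ j ∈ q.support, t ^ j • J (q.coeff j))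
      (∑ j ∈ q.support, ((j : ℂ) * 0 ^ (j - 1)) • J (q.coeff j)) 0 :=
    HasDerivAt.fun_sum fun j _ => (hasDerivAt_pow j (0 : ℂ)).smul_const _
  have h3 : ((fun c => J (MvPolynomial.aeval (polyPerturbation ξ c) f)) ∘
      fun t : ℂ => t • c) = fun t : ℂ => ∑ j ∈ q.support, t ^ j • J (q.coeff j) := by
    funext t
    simp only [Function.comp_apply, hq, map_sum, map_smul]
  rw [h3, zero_smul] at h1
  rw [h1.unique h2, ← hq1, Finset.sum_eq_single 1]
  · simp
  · intro j _ hj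
    rcases j with _ | _ | j
    · simp
    · exact absurd rfl hj
    · simp
  · intro h
    rw [Polynomial.notMem_support_iff.1 h]
    simp

/-- If the infinitesimal actions of the `ξ k` on `f` span a subspace containing all the images of
`f ∘ (id + ∑ c k • ξ k)`, then these images fill a neighbourhood in that subspace. -/
theorem exists_nhds_polyPerturbation_eq (J : MvPolynomial (Fin n) ℂ →ₗ[ℂ] V)
    (ξ : κ → Fin n → MvPolynomial (Fin n) ℂ) (f : MvPolynomial (Fin n) ℂ) (W : Submodule ℂ V)
    [FiniteDimensional ℂ W]
    (hW : ∀ c, J (MvPolynomial.aeval (polyPerturbation ξ c) f) ∈ W)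
    (hspan : W ≤ Submodule.span ℂ
      (Set.range fun k => J (∑ i, ξ k i * MvPolynomial.pderiv i f)))
    {Ω : Set (κ → ℂ)} (hΩ : Ω ∈ 𝓝 0) :
    ∃ U ∈ 𝓝 (J f), ∀ j ∈ U, j ∈ W →
      ∃ c ∈ Ω, J (MvPolynomial.aeval (polyPerturbation ξ c) f) = j := by
  obtain ⟨L, hL, hLc⟩ := hasStrictFDerivAt_polyPerturbation J ξ f
  have hLc' : ∀ c, L c = ∑ k, c k • J (∑ i, ξ k i * MvPolynomial.pderiv i f) := by
    intro c
    rw [hLc]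
    simp only [← map_smul, ← map_sum]
    congr 1
    simp only [Finset.sum_mul, Finset.smul_sum, smul_mul_assoc]
    exact Finset.sum_comm
  -- A continuous projection onto `W` makes the derivative surjective. It loses nothing, because the
  -- images already lie in `W`.
  obtain ⟨π, hπ⟩ := Submodule.ClosedComplemented.of_finiteDimensional (𝕜 := ℂ) W
  have hπL := π.hasStrictFDerivAt.comp 0 hL
  have hrange : (π.comp L).range = ⊤ := by
    refine LinearMap.range_eq_top.2 fun v => ?_
    obtain ⟨c, hc⟩ := (Submodule.mem_span_range_iff_exists_fun ℂ).1 (hspan v.2)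
    refine ⟨c, ?_⟩
    change π (L c) = v
    rw [hLc', hc, hπ]
  have : CompleteSpace W := FiniteDimensional.complete ℂ W
  have himg := image_mem_map 
    (m := fun c => π (J (MvPolynomial.aeval (polyPerturbation ξ c) f))) hΩ
  have h0 : polyPerturbation ξ 0 = MvPolynomial.X := by
    funext i
    simp [polyPerturbation]
  rw [hπL.map_nhds_eq_of_surj hrange, h0, MvPolynomial.aeval_X_left_apply] at himg
  refine ⟨_, π.continuous.continuousAt.preimage_mem_nhds himg, ?_⟩
  rintro j ⟨c, hc, hcj⟩ hj
  refine ⟨c, hc, ?_⟩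
  exact congrArg Subtype.val ((hπ ⟨_, hW c⟩).symm.trans (hcj.trans (hπ ⟨j, hj⟩)))

theorem eventually_isUnit_one_add_sum_smul {A : Type*} [NormedRing A] [NormedAlgebra ℂ A]
    [CompleteSpace A] (a : κ → A) : ∀ᶠ c in 𝓝 (0 : κ → ℂ), IsUnit (1 + ∑ k, c k • a k) := by
  have hc : Continuous fun c : κ → ℂ => 1 + ∑ k, c k • a k := by fun_prop
  refine (hc.tendsto 0).eventually (Units.isOpen.mem_nhds ?_)
  simp

theorem MvPolynomial.eval_aeval (P : Fin n → MvPolynomial (Fin n) ℂ) (f : MvPolynomial (Fin n) ℂ)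
    (x : Fin n → ℂ) : eval x (aeval P f) = eval (fun i => eval x (P i)) f := by
  induction f using MvPolynomial.induction_on with
  | C a => simp [algebraMap_eq]
  | add f g hf hg => rw [map_add, map_add, map_add, hf, hg]
  | mul_X f i hf => rw [map_mul, map_mul, map_mul, hf, aeval_X, eval_X]

theorem polyPerturbation_isWeightedHomogeneous {w : Fin n → ZMod p}
    {ξ : κ → Fin n → MvPolynomial (Fin n) ℂ}
    (hξ : ∀ k i, (ξ k i).IsWeightedHomogeneous w (w i)) (c : κ → ℂ) (i : Fin n) :
    (polyPerturbation ξ c i).IsWeightedHomogeneous w (w i) :=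
  (MvPolynomial.isWeightedHomogeneous_X ℂ w i).add
    (Submodule.sum_mem (MvPolynomial.weightedHomogeneousSubmodule ℂ w (w i)) fun k _ =>
      Submodule.smul_mem _ _ (hξ k i))

/-- Nonzero weights force the perturbed map to fix the origin; its linear part is a small
perturbation of the identity, hence invertible. -/
theorem isEquivariantDiffeoGerm_polyPerturbation [NeZero p] {w : Fin n → ZMod p}
    (hw : ∀ i, w i ≠ 0) {ξ : κ → Fin n → MvPolynomial (Fin n) ℂ}
    (hξ : ∀ k i, (ξ k i).IsWeightedHomogeneous w (w i)) :
    ∀ᶠ c in 𝓝 (0 : κ → ℂ), IsEquivariantDiffeoGerm (diagRep p w)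
      fun x i => MvPolynomial.eval x (polyPerturbation ξ c i) := by
  have hhom := polyPerturbation_isWeightedHomogeneous hξ
  have hξa : ∀ k, AnalyticAt ℂ (fun x i => MvPolynomial.eval x (ξ k i)) 0 := fun k =>
    AnalyticAt.pi fun i => MvPolynomial.analyticAt_eval _ 0
  have hderiv : ∀ c : κ → ℂ,
      HasFDerivAt (fun x i => MvPolynomial.eval x (polyPerturbation ξ c i))
        (1 + ∑ k, c k • fderiv ℂ (fun x i => MvPolynomial.eval x (ξ k i)) 0) (0 : Fin n → ℂ) := by
    intro c
    have h1 : HasFDerivAt (fun x : Fin n → ℂ => x + ∑ k, c k • fun i => MvPolynomial.eval x (ξ k i))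
        (ContinuousLinearMap.id ℂ _ +
          ∑ k, c k • fderiv ℂ (fun x i => MvPolynomial.eval x (ξ k i)) 0) 0 :=
      (hasFDerivAt_id _).add (HasFDerivAt.fun_sum fun k _ =>
        (hξa k).differentiableAt.hasFDerivAt.const_smul (c k))
    convert h1 using 1
    · funext x i
      simp [polyPerturbation]
    · rfl
  filter_upwards [eventually_isUnit_one_add_sum_smul fun k =>
    fderiv ℂ (fun x i => MvPolynomial.eval x (ξ k i)) (0 : Fin n → ℂ)] with c hc
  have ha : AnalyticAt ℂ (fun x i => MvPolynomial.eval x (polyPerturbation ξ c i)) 0 :=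
    AnalyticAt.pi fun i => MvPolynomial.analyticAt_eval _ 0
  have h0 : (fun i => MvPolynomial.eval (0 : Fin n → ℂ) (polyPerturbation ξ c i)) = 0 :=
    funext fun i => (hhom c i).eval_zero (hw i)
  refine ⟨ha, h0, exists_local_inverse ha h0 (by rwa [(hderiv c).fderiv]), fun g => ?_⟩
  refine Eventually.of_forall fun x => funext fun i => ?_
  rw [(hhom c i).eval_diagRep, diagRep_apply]

theorem MvPolynomial.IsWeightedHomogeneous.aeval {M : Type*} [AddCommMonoid M] {w : Fin n → M}
    {m : M} {f : MvPolynomial (Fin n) ℂ} (hf : f.IsWeightedHomogeneous w m)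
    {P : Fin n → MvPolynomial (Fin n) ℂ} (hP : ∀ i, (P i).IsWeightedHomogeneous w (w i)) :
    (aeval P f).IsWeightedHomogeneous w m := by
  rw [f.as_sum, map_sum]
  refine IsWeightedHomogeneous.sum _ _ _ fun a ha => ?_
  rw [aeval_monomial, algebraMap_eq, ← hf (mem_support_iff.1 ha), Finsupp.prod_fintype _ _ (by simp),
    Finsupp.weight_apply, Finsupp.sum_fintype _ _ (by simp)]
  exact (IsWeightedHomogeneous.prod _ _ _ fun i _ => (hP i).pow (a i)).C_mul _

/-- If every nonconstant invariant monomial is an infinitesimal equivariant coordinate change of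
`f`, then every invariant jet close to the jet of `f` is obtained from `f` by an equivariant
coordinate change. -/
theorem exists_nhds_jet_comp_eq [NeZero p] {w : Fin n → ZMod p} (hw : ∀ i, w i ≠ 0)
    {f : MvPolynomial (Fin n) ℂ} (hf : f.IsWeightedHomogeneous w 0) (hf0 : f.coeff 0 = 0)
    (hT : ∀ a : Fin n →₀ ℕ, Finsupp.weight w a = 0 → a ≠ 0 →
      MvPolynomial.monomial a 1 ∈ orbitTangent w f) (r : ℕ) :
    ∃ U ∈ 𝓝 (jet r fun x => MvPolynomial.eval x f), ∀ j ∈ U ∩ invariantJets (diagRep p w) r,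
      ∃ φ, IsEquivariantDiffeoGerm (diagRep p w) φ ∧
        jet r ((fun x => MvPolynomial.eval x f) ∘ φ) = j := by
  have : Fintype (invariantExponents w r) := (finite_invariantExponents w r).fintype
  choose ξ hξ hξf using fun a : invariantExponents w r => hT a a.2.1 a.2.2.1
  have hmem : ∀ c, polyJet n r (MvPolynomial.aeval (polyPerturbation ξ c) f) ∈
      invariantJetSpan w r := by
    intro c
    have hhom := polyPerturbation_isWeightedHomogeneous hξ c
    refine polyJet_mem r (hf.aeval hhom) ?_
    have h0 : (fun i => MvPolynomial.eval 0 (polyPerturbation ξ c i)) = 0 :=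
      funext fun i => (hhom i).eval_zero (hw i)
    rw [← MvPolynomial.constantCoeff_eq, ← MvPolynomial.eval_zero, MvPolynomial.eval_aeval, h0,
      MvPolynomial.eval_zero, MvPolynomial.constantCoeff_eq, hf0]
  have hspan : invariantJetSpan w r ≤ Submodule.span ℂ
      (Set.range fun k => polyJet n r (∑ i, ξ k i * MvPolynomial.pderiv i f)) := by
    simp only [← hξf, invariantJetSpan, Set.image_eq_range]
    exact le_rfl
  obtain ⟨U, hU, hUj⟩ := exists_nhds_polyPerturbation_eq (polyJet n r) ξ f (invariantJetSpan w r)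
    hmem hspan (isEquivariantDiffeoGerm_polyPerturbation hw hξ)
  refine ⟨U, hU, fun j hj => ?_⟩
  obtain ⟨c, hc, rfl⟩ := hUj j hj.1 (invariantJets_subset w r hj.2)
  refine ⟨_, hc, ?_⟩
  rw [polyJet_apply]
  congr 1
  funext x
  exact (MvPolynomial.eval_aeval _ f x).symm

end OpenOrbit

/-! ### The tangent space of the loop polynomial -/

section Loop

variable {n p : ℕ}

theorem loopPolynomial_eq_sum_monomial (d : Fin n → ℕ) :
    loopPolynomial d = ∑ i, MvPolynomial.monomial
      (Finsupp.single i (d i) + Finsupp.single (finRotate n i) 1) 1 := by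
  refine Finset.sum_congr rfl fun i _ => ?_
  rw [MvPolynomial.X_pow_eq_monomial, MvPolynomial.X, MvPolynomial.monomial_mul, one_mul]

theorem loopPolynomial_isWeightedHomogeneous {d : Fin n → ℕ} {w : Fin n → ZMod p}
    (hw : ∀ i, d i • w i + w (finRotate n i) = 0) :
    (loopPolynomial d).IsWeightedHomogeneous w 0 := by
  refine MvPolynomial.IsWeightedHomogeneous.sum _ _ _ fun i _ => ?_
  rw [← hw i]
  exact ((MvPolynomial.isWeightedHomogeneous_X ℂ w i).pow _).mul
    (MvPolynomial.isWeightedHomogeneous_X ℂ w _)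

theorem coeff_zero_loopPolynomial (d : Fin n → ℕ) : (loopPolynomial d).coeff 0 = 0 := by
  simp [← MvPolynomial.constantCoeff_eq, loopPolynomial]

theorem jet_two_loopPolynomial {d : Fin n → ℕ} (hd : ∀ i, 2 ≤ d i) :
    (jet 2 fun x => MvPolynomial.eval x (loopPolynomial d)) = 0 := by
  rw [← polyJet_apply, loopPolynomial_eq_sum_monomial, map_sum]
  refine Finset.sum_eq_zero fun i _ => polyJet_monomial_eq_zero ?_ 1
  have := hd i
  simp only [map_add, Finsupp.degree_single]
  omega

theorem pderiv_loopPolynomial (d : Fin n → ℕ) (i : Fin n) :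
    MvPolynomial.pderiv (finRotate n i) (loopPolynomial d) =
      MvPolynomial.X i ^ d i + (d (finRotate n i) : MvPolynomial (Fin n) ℂ) *
        MvPolynomial.X (finRotate n i) ^ (d (finRotate n i) - 1) *
          MvPolynomial.X (finRotate n (finRotate n i)) := by
  simp only [loopPolynomial, map_sum, Derivation.leibniz, Derivation.leibniz_pow,
    MvPolynomial.pderiv_X, Finset.sum_add_distrib]
  congr 1
  · rw [Finset.sum_eq_single i]
    · simp
    · intro j _ hj
      simp [hj]
    · simp
  · rw [Finset.sum_eq_single (finRotate n i)]
    · simp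
      ring
    · intro j _ hj
      simp only [Pi.single_eq_of_ne hj, smul_zero]
    · simp

/-- Modulo `orbitTangent`, the factor `xᵢ ^ dᵢ` of an invariant monomial can be replaced by
a multiple of `xᵢ₊₁ ^ (dᵢ₊₁ - 1) * xᵢ₊₂`. -/
theorem monomial_add_mem_orbitTangent {d : Fin n → ℕ} {w : Fin n → ZMod p}
    (hw : ∀ i, d i • w i + w (finRotate n i) = 0) {b : Fin n →₀ ℕ} {i : Fin n}
    (hb : Finsupp.weight w (b + Finsupp.single i (d i)) = 0) :
    MvPolynomial.monomial (b + Finsupp.single i (d i)) 1 + (d (finRotate n i) : ℂ) •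
      MvPolynomial.monomial (b + Finsupp.single (finRotate n i) (d (finRotate n i) - 1) +
        Finsupp.single (finRotate n (finRotate n i)) 1) 1 ∈ orbitTangent w (loopPolynomial d) := by
  -- The vector field is `x ^ b ∂/∂xᵢ₊₁`. It is equivariant: both `b + dᵢ eᵢ` and `dᵢ eᵢ + eᵢ₊₁`
  -- have weight zero, so `b` has the weight of `xᵢ₊₁`.
  refine ⟨Pi.single (finRotate n i) (MvPolynomial.monomial b 1), fun j => ?_, ?_⟩
  · by_cases hj : j = finRotate n i
    · subst hj
      rw [Pi.single_eq_same]
      refine MvPolynomial.isWeightedHomogeneous_monomial _ _ _ ?_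
      rw [map_add, Finsupp.weight_single] at hb
      linear_combination hb - hw i
    · rw [Pi.single_eq_of_ne hj]
      exact MvPolynomial.isWeightedHomogeneous_zero _ _ _
  · rw [Finset.sum_eq_single (finRotate n i)]
    · rw [Pi.single_eq_same, pderiv_loopPolynomial, MvPolynomial.X_pow_eq_monomial,
        MvPolynomial.X_pow_eq_monomial, MvPolynomial.X, mul_add, MvPolynomial.monomial_mul,
        mul_assoc, MvPolynomial.monomial_mul, mul_left_comm, MvPolynomial.monomial_mul,
        MvPolynomial.smul_eq_C_mul, add_assoc]
      simp
    · intro j _ hj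
      rw [Pi.single_eq_of_ne hj, zero_mul]
    · simp

/-- If the only invariant exponent in the box `∏ [0, dᵢ)` is zero, then every nonconstant invariant
monomial is an infinitesimal equivariant coordinate change of the loop polynomial. -/
theorem monomial_mem_orbitTangent {d : Fin n → ℕ} {w : Fin n → ZMod p} {q : Fin n → ℕ} {D : ℕ}
    (hd : ∀ i, 2 ≤ d i) (hw : ∀ i, d i • w i + w (finRotate n i) = 0)
    (hq0 : ∀ i, q i ≠ 0) (hq : ∀ i, d i * q i + q (finRotate n i) = D)
    (hbox : ∀ a : Fin n →₀ ℕ, (∀ i, a i < d i) → Finsupp.weight w a = 0 → a = 0)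
    {a : Fin n →₀ ℕ} (ha : Finsupp.weight w a = 0) (ha0 : a ≠ 0) :
    MvPolynomial.monomial a 1 ∈ orbitTangent w (loopPolynomial d) := by
  by_contra hmem
  obtain ⟨l, hl, hker⟩ := Submodule.exists_le_ker_of_notMem hmem
  -- Fixing the quasi-degree leaves finitely many monomials, so a nonzero value of `l` of least norm
  -- exists.
  set S : Set (Fin n →₀ ℕ) := {c | (Finsupp.weight w c = 0 ∧ c ≠ 0 ∧
    Finsupp.weight q c = Finsupp.weight q a) ∧ l (MvPolynomial.monomial c 1) ≠ 0} with hS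
  have hfin : S.Finite := (Finsupp.finite_of_nat_weight_le q hq0 (Finsupp.weight q a)).subset
    fun c hc => hc.1.2.2.le
  obtain ⟨c, ⟨⟨hcw, hc0, hcq⟩, hcl⟩, hmin⟩ :=
    Set.exists_min_image S (fun c => ‖l (MvPolynomial.monomial c 1)‖) hfin
      ⟨a, ⟨ha, ha0, rfl⟩, hl⟩
  obtain ⟨i, hi⟩ : ∃ i, d i ≤ c i := by
    by_contra! h
    exact hc0 (hbox c h hcw)
  obtain ⟨b, rfl⟩ : ∃ b, c = b + Finsupp.single i (d i) :=
    ⟨c - Finsupp.single i (d i), (tsub_add_cancel_of_le (Finsupp.single_le_iff.2 hi)).symm⟩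
  have hT := hker (monomial_add_mem_orbitTangent hw hcw)
  set c' := b + Finsupp.single (finRotate n i) (d (finRotate n i) - 1) +
    Finsupp.single (finRotate n (finRotate n i)) 1 with hc'
  rw [LinearMap.mem_ker, map_add, map_smul, smul_eq_mul] at hT
  have hl' : l (MvPolynomial.monomial c' 1) ≠ 0 := by
    intro h
    rw [h, mul_zero, add_zero] at hT
    exact hcl hT
  obtain ⟨e, he⟩ := Nat.exists_eq_add_of_le' (one_le_two.trans (hd (finRotate n i)))
  have hc'S : c' ∈ S := by
    refine ⟨⟨?_, ?_, ?_⟩, hl'⟩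
    · have h1 := hw i
      have h2 := hw (finRotate n i)
      simp only [hc', map_add, Finsupp.weight_single, he, Nat.add_sub_cancel, add_smul,
        one_smul] at hcw h2 ⊢
      linear_combination hcw - h1 + h2
    · intro h
      have := DFunLike.congr_fun h (finRotate n (finRotate n i))
      simp [hc'] at this
    · have h1 := hq i
      have h2 := hq (finRotate n i)
      rw [← hcq]
      simp only [hc', map_add, Finsupp.weight_single, he, Nat.add_sub_cancel, smul_eq_mul,
        one_mul] at h2 ⊢
      linarith
  have hle := hmin c' hc'S
  -- Since `l` kills the relation, the value at `c'` has norm at most half of that at the minimizer,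
  -- a contradiction.
  have hnorm : ‖l (MvPolynomial.monomial (b + Finsupp.single i (d i)) 1)‖ =
      d (finRotate n i) * ‖l (MvPolynomial.monomial c' 1)‖ := by
    rw [eq_neg_of_add_eq_zero_left hT, norm_neg, norm_mul, Complex.norm_natCast]
  have h2 : (2 : ℝ) ≤ d (finRotate n i) := by exact_mod_cast hd _
  have hpos : 0 < ‖l (MvPolynomial.monomial c' 1)‖ := norm_pos_iff.2 hl'
  simp only [hnorm] at hle
  nlinarith

end Loop

/-! ### Uniqueness of expansions in base -2 -/

section NegativeBase

/-- Expansions in base `-2` with unrestricted leading digit represent zero only trivially. -/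
theorem eq_zero_of_sum_mul_neg_two_pow_eq_zero : ∀ {k : ℕ} {a : Fin (k + 1) → ℕ},
    (∀ i, i ≠ Fin.last k → a i < 2) → ∑ i, (a i : ℤ) * (-2) ^ (i : ℕ) = 0 → a = 0 := by
  intro k
  induction k with
  | zero =>
    intro a _ h
    funext i
    fin_cases i
    simpa using h
  | succ k ih =>
    intro a ha h
    rw [Fin.sum_univ_succ] at h
    have h1 : ∑ i : Fin (k + 1), (a i.succ : ℤ) * (-2) ^ (i.succ : ℕ) =
        (-2) * ∑ i : Fin (k + 1), (a i.succ : ℤ) * (-2) ^ (i : ℕ) := by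
      rw [Finset.mul_sum]
      exact Finset.sum_congr rfl fun i _ => by rw [Fin.val_succ]; ring
    rw [h1, Fin.val_zero, pow_zero, mul_one] at h
    -- The equation makes the digit `a 0` even; being below 2 it vanishes, and so does the remaining
    -- sum.
    have h0 := ha 0 (Fin.last_pos.ne)
    have hsucc := ih (a := fun i => a i.succ)
      (fun i hi => ha _ (by simpa [← Fin.succ_last] using hi)) (by omega)
    funext i
    refine Fin.cases ?_ (fun j => congrFun hsucc j) i
    simp only [Pi.zero_apply]
    omega

end NegativeBase

/-! ### Arithmetic of the chosen exponents and weights -/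

section ChosenLoop

/-- The exponents `2, …, 2, m` of the loop polynomial in `k + 1` variables. -/
def loopExponents (k m : ℕ) (i : Fin (k + 1)) : ℕ :=
  if i = Fin.last k then m else 2

theorem loopExponents_last (k m : ℕ) : loopExponents k m (Fin.last k) = m := if_pos rfl

theorem loopExponents_of_ne {k m : ℕ} {i : Fin (k + 1)} (h : i ≠ Fin.last k) :
    loopExponents k m i = 2 := if_neg h

theorem two_le_loopExponents {k m : ℕ} (hm : 2 ≤ m) (i : Fin (k + 1)) :
    2 ≤ loopExponents k m i := by
  unfold loopExponents
  split_ifs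
  · exact hm
  · exact le_rfl

theorem prod_loopExponents (k m : ℕ) : ∏ i, loopExponents k m i = 2 ^ k * m := by
  rw [Fin.prod_univ_castSucc, loopExponents_last]
  congr 1
  rw [Finset.prod_congr rfl fun i _ => loopExponents_of_ne (Fin.castSucc_lt_last i).ne]
  simp

theorem val_finRotate_of_ne {k : ℕ} {i : Fin (k + 1)} (h : i ≠ Fin.last k) :
    (finRotate (k + 1) i : ℕ) = i + 1 :=
  coe_finRotate_of_ne_last h

/-- The weight `(-2) ^ i` of the `i`-th variable. -/
def negTwoPow (k p : ℕ) (i : Fin (k + 1)) : ZMod p := (-2) ^ (i : ℕ)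

variable {k m p : ℕ}

/-- Evenness of `k` gives `(-2) ^ k = 2 ^ k`, so the closing relation reads `2 ^ k * m + 1 = p = 0`.
-/
theorem loopExponents_smul_negTwoPow (hk : Even k) (hp : p = 2 ^ k * m + 1) (i : Fin (k + 1)) :
    loopExponents k m i • negTwoPow k p i + negTwoPow k p (finRotate (k + 1) i) = 0 := by
  unfold negTwoPow
  by_cases h : i = Fin.last k
  · subst h
    have : ((2 ^ k * m + 1 : ℕ) : ZMod p) = 0 := by rw [← hp, ZMod.natCast_self]
    push_cast at this
    rw [loopExponents_last, finRotate_last, Fin.val_last, hk.neg_pow, nsmul_eq_mul]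
    simpa [mul_comm] using this
  · rw [loopExponents_of_ne h, val_finRotate_of_ne h, nsmul_eq_mul, pow_succ]
    push_cast
    ring

/-- The quasi-degrees of the variables, for which the loop polynomial has degree `3 * p`. -/
def loopDegree (k m p : ℕ) (i : Fin (k + 1)) : ℕ :=
  ((p : ℤ) + (2 - m) * (-2) ^ (i : ℕ)).toNat

/-- The correction is at most `(m - 2) * 2 ^ k < p` in absolute value; hence `toNat` in `loopDegree`
truncates nothing. -/
theorem loopDegree_pos (hm : 2 ≤ m) (hp : p = 2 ^ k * m + 1) (i : Fin (k + 1)) :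
    0 < (p : ℤ) + (2 - m) * (-2) ^ (i : ℕ) := by
  have h1 : |((2 : ℤ) - m) * (-2) ^ (i : ℕ)| ≤ (m - 2) * 2 ^ k := by
    rw [abs_mul, abs_pow, abs_neg, abs_two, abs_sub_comm, abs_of_nonneg (by omega)]
    have h2 : (2 : ℤ) ^ (i : ℕ) ≤ 2 ^ k := pow_le_pow_right₀ (by norm_num) (Nat.le_of_lt_succ i.2)
    exact mul_le_mul_of_nonneg_left h2 (by omega)
  have h2 := neg_le_of_abs_le h1
  have h3 : (p : ℤ) = 2 ^ k * m + 1 := by exact_mod_cast hp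
  have h4 : (0 : ℤ) < 2 ^ k := by positivity
  nlinarith

/-- The recursion `qᵢ₊₁ = 3p - 2qᵢ` has solutions `p + c * (-2) ^ i`, and the closing equation `m *
q_k + q₀ = 3p` forces `c = 2 - m`. -/
theorem loopExponents_mul_loopDegree (hk : Even k) (hm : 2 ≤ m) (hp : p = 2 ^ k * m + 1)
    (i : Fin (k + 1)) :
    loopExponents k m i * loopDegree k m p i + loopDegree k m p (finRotate (k + 1) i) = 3 * p := by
  zify
  unfold loopDegree
  rw [Int.toNat_of_nonneg (loopDegree_pos hm hp _).le,
    Int.toNat_of_nonneg (loopDegree_pos hm hp _).le]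
  have h3 : (p : ℤ) = 2 ^ k * m + 1 := by exact_mod_cast hp
  by_cases h : i = Fin.last k
  · subst h
    rw [loopExponents_last, finRotate_last, Fin.val_last, hk.neg_pow]
    simp only [Fin.val_zero, pow_zero]
    linear_combination (m - 2 : ℤ) * h3
  · rw [loopExponents_of_ne h, val_finRotate_of_ne h, pow_succ]
    push_cast
    ring

/-- The integer weight is at most `(2 ^ k - 1) + (m - 1) * 2 ^ k = p - 2` in absolute value, so
divisibility by `p` makes it zero, and the base `-2` lemma applies. -/
theorem eq_zero_of_lt_loopExponents (hp : p = 2 ^ k * m + 1) {a : Fin (k + 1) →₀ ℕ}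
    (ha : ∀ i, a i < loopExponents k m i) (hw : Finsupp.weight (negTwoPow k p) a = 0) : a = 0 := by
  have h1 : ((∑ i, (a i : ℤ) * (-2) ^ (i : ℕ) : ℤ) : ZMod p) = 0 := by
    rw [Finsupp.weight_apply, Finsupp.sum_fintype _ _ (by simp)] at hw
    simpa [negTwoPow] using hw
  have h2 : |∑ i, (a i : ℤ) * (-2) ^ (i : ℕ)| < p := by
    have hlast := ha (Fin.last k)
    rw [loopExponents_last] at hlast
    have hgeom : ∑ i : Fin k, (2 : ℤ) ^ (i : ℕ) = 2 ^ k - 1 := by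
      rw [Fin.sum_univ_eq_sum_range fun i => (2 : ℤ) ^ i]
      have := geom_sum_mul (2 : ℤ) k
      linarith
    calc |∑ i, (a i : ℤ) * (-2) ^ (i : ℕ)| ≤ ∑ i, |(a i : ℤ) * (-2) ^ (i : ℕ)| :=
          Finset.abs_sum_le_sum_abs _ _
      _ = ∑ i : Fin (k + 1), (a i : ℤ) * 2 ^ (i : ℕ) := by
          refine Finset.sum_congr rfl fun i _ => ?_
          rw [abs_mul, abs_pow, abs_neg, abs_two, Nat.abs_cast]
      _ ≤ ∑ i : Fin k, (2 : ℤ) ^ (i : ℕ) + (m - 1) * 2 ^ k := by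
          rw [Fin.sum_univ_castSucc]
          refine add_le_add (Finset.sum_le_sum fun i _ => ?_) ?_
          · have := ha i.castSucc
            rw [loopExponents_of_ne (Fin.castSucc_lt_last i).ne] at this
            have h3 : (a i.castSucc : ℤ) ≤ 1 := by omega
            simpa using mul_le_mul_of_nonneg_right h3 (by positivity : (0 : ℤ) ≤ 2 ^ (i : ℕ))
          · rw [Fin.val_last]
            exact mul_le_mul_of_nonneg_right (by omega) (by positivity)
      _ < p := by
          have h3 : (p : ℤ) = 2 ^ k * m + 1 := by exact_mod_cast hp
          rw [hgeom, h3]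
          linarith
  have h3 := Int.eq_zero_of_abs_lt_dvd ((ZMod.intCast_zmod_eq_zero_iff_dvd _ p).1 h1) h2
  refine DFunLike.coe_injective (eq_zero_of_sum_mul_neg_two_pow_eq_zero (fun i hi => ?_) h3)
  have := ha i
  rwa [loopExponents_of_ne hi] at this

end ChosenLoop

/-! ### Corank, simplicity and the choice of the prime -/

section Simple

variable {n : ℕ} {f : (Fin n → ℂ) → ℂ}

theorem fderiv_eq_zero_of_jet_two_eq_zero (h : jet 2 f = 0) : fderiv ℂ f 0 = 0 := by
  have h1 : iteratedFDeriv ℂ 1 f 0 = 0 := congrFun h 1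
  ext v
  have := congrArg (fun m => m fun _ => v) h1
  simpa [iteratedFDeriv_one_apply] using this

theorem corank_eq_of_jet_two_eq_zero (h : jet 2 f = 0) : corank f = n := by
  have h1 : iteratedFDeriv ℂ 2 f 0 = 0 := congrFun h 2
  have h2 : fderiv ℂ (fderiv ℂ f) 0 = 0 := by
    ext u v
    have := congrArg (fun m => m ![u, v]) h1
    simpa [iteratedFDeriv_two_apply] using this
  rw [corank, h2, ContinuousLinearMap.toLinearMap_zero, LinearMap.ker_zero, finrank_top]
  simp

theorem isEquivariantlySimple_of_exists_nhds {G : Type} [Group G]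
    {ρ : Representation ℂ G (Fin n → ℂ)} (hf : IsInvariantCriticalGerm ρ f)
    (h : ∀ r, ∃ U ∈ 𝓝 (jet r f), ∀ j ∈ U ∩ invariantJets ρ r,
      ∃ φ, IsEquivariantDiffeoGerm ρ φ ∧ jet r (f ∘ φ) = j) :
    IsEquivariantlySimple ρ f := by
  refine ⟨hf, 1, Eventually.of_forall fun r => ?_⟩
  obtain ⟨U, hU, hUj⟩ := h r
  refine ⟨U, hU, ?_⟩
  have hsub : jetOrbit ρ r '' (U ∩ invariantJets ρ r) ⊆ {jetOrbit ρ r (jet r f)} := by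
    rintro _ ⟨j, hj, rfl⟩
    obtain ⟨φ, hφ, rfl⟩ := hUj j hj
    exact jetOrbit_jet_comp hf hφ
  exact (Set.encard_le_encard hsub).trans (by simp)

theorem exists_prime_eq_two_pow_mul_add_one (k : ℕ) :
    ∃ p m : ℕ, p.Prime ∧ 2 < p ∧ 2 ≤ m ∧ p = 2 ^ k * m + 1 := by
  -- The modulus `2 ^ (k + 1)` instead of `2 ^ k` makes `m` even and nonzero, hence at least 2.
  obtain ⟨p, hp, h2, hmod⟩ := Nat.exists_prime_gt_modEq_one (k := 2 ^ (k + 1)) 2 (by positivity)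
  obtain ⟨t, ht⟩ := (Nat.modEq_iff_dvd' hp.one_le).1 hmod.symm
  refine ⟨p, 2 * t, hp, h2, ?_, ?_⟩
  · have : t ≠ 0 := by
      rintro rfl
      omega
    omega
  · rw [pow_succ, mul_assoc] at ht
    omega

end Simple

theorem theorem1p3 (N : ℕ) :
    ∃ (p n : ℕ) (ρ : Representation ℂ (Multiplicative (ZMod p)) (Fin n → ℂ))
      (f : (Fin n → ℂ) → ℂ),
      p.Prime ∧ N < n ∧ (∃ g, ρ g ≠ 1) ∧
      IsEquivariantlySimple ρ f ∧ jet 2 f = 0 ∧ corank f = n ∧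
      ∃ d : Fin n → ℕ, (∀ i, 2 ≤ d i) ∧ p = (∏ i, d i) + 1 ∧
        f = fun x => MvPolynomial.eval x (loopPolynomial d) := by
  -- Even, so that the weights close up around the loop, and large enough that `k + 1 > N`.
  set k := 2 * (N + 1) with hkN
  have hk : Even k := even_two_mul _
  obtain ⟨p, m, hpp, hp2, hm, hp⟩ := exists_prime_eq_two_pow_mul_add_one k
  have : Fact p.Prime := ⟨hpp⟩
  set d := loopExponents k m
  set w := negTwoPow k p
  have hd : ∀ i, 2 ≤ d i := two_le_loopExponents hm
  have hw : ∀ i, d i • w i + w (finRotate (k + 1) i) = 0 := loopExponents_smul_negTwoPow hk hp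
  have hw0 : ∀ i, w i ≠ 0 := by
    intro i
    have h2 : ((2 : ℕ) : ZMod p) ≠ 0 := by
      rw [Ne, ZMod.natCast_eq_zero_iff]
      exact Nat.not_dvd_of_pos_of_lt two_pos hp2
    exact pow_ne_zero _ (neg_ne_zero.2 (by exact_mod_cast h2))
  have hhom := loopPolynomial_isWeightedHomogeneous hw
  have hjet := jet_two_loopPolynomial hd
  refine ⟨p, k + 1, diagRep p w, fun x => MvPolynomial.eval x (loopPolynomial d), hpp, by omega,
    ⟨Multiplicative.ofAdd 1, fun h => ?_⟩, ?_, hjet, corank_eq_of_jet_two_eq_zero hjet, d, hd, ?_,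
    rfl⟩
  -- If the generator acted trivially, the character would be 1 at `w 0`; injectivity of the
  -- standard character would give `w 0 = 0`.
  · have h1 := congrFun (LinearMap.congr_fun h 1) 0
    rw [diagRep_apply] at h1
    have h2 : ZMod.stdAddChar (w 0) = (1 : ℂ) := by simpa using h1
    rw [← AddChar.map_zero_eq_one (ZMod.stdAddChar (N := p))] at h2
    exact hw0 0 (ZMod.injective_stdAddChar h2)
  · refine isEquivariantlySimple_of_exists_nhds ⟨MvPolynomial.analyticAt_eval _ 0, ?_,
      fderiv_eq_zero_of_jet_two_eq_zero hjet, fun g => Eventually.of_forall fun x => ?_⟩ fun r =>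
      exists_nhds_jet_comp_eq hw0 hhom (coeff_zero_loopPolynomial d) (fun a ha ha0 =>
        monomial_mem_orbitTangent hd hw (fun i => ?_) (loopExponents_mul_loopDegree hk hm hp)
          (fun a => eq_zero_of_lt_loopExponents hp) ha ha0) r
    · rw [MvPolynomial.eval_zero, MvPolynomial.constantCoeff_eq, coeff_zero_loopPolynomial]
    · rw [hhom.eval_diagRep]
      simp
    · have := loopDegree_pos hm hp i
      unfold loopDegree
      omega
  · rw [prod_loopExponents, hp]
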